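/- Let $Q=(q_n)_{n\ge 1}$ be a basic sequence, i.e. a sequence of integers $q_n\ge 2$, and suppose that $Q$ is infinite in limit, i.e. $q_n\to\infty$. Every real number $x$ has a unique $Q$-Cantor series expansion $$x=\lfloor x\rfloor+\sum_{n=1}^\infty \frac{E_n}{q_1q_2\cdots q_n},\qquad E_n\in\{0,1,\ldots,q_n-1\},\qquad E_n\ne q_n-1 \text{ for infinitely many } n.$$ For a block $B=(b_1,\ldots,b_k)$ of non-negative integers, let $N_n^Q(B,x)$ be the number of $i\in\{1,\ldots,n\}$ with $(E_i,E_{i+1},\ldots,E_{i+k-1})=B$. For $k\ge1$, let $\mathscr{RN}_k(Q)$, the set of numbers that are $Q$-ratio normal of order $k$, be the set of all $x\in\mathbb{R}$ such that for all blocks $B_1,B_2$ of length $k$ $$\lim_{n\to\infty}\frac{N_n^Q(B_1,x)}{N_n^Q(B_2,x)}=1$$ (in particular, the denominator is nonzero for all large $n$). Let $\mathscr{DN}(Q)$, the set of $Q$-distribution normal numbers, be the set of all $x\in\mathbb{R}$ such that the sequence $\left(q_1q_2\cdots q_n\,x \bmod 1\right)_{n=0}^\infty$ is uniformly distributed mod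 $1$. Then $$\dim_{\mathrm H}\left(\mathscr{DN}(Q)\setminus\bigcup_{j=1}^\infty \mathscr{RN}_j(Q)\right)=1,$$ where $\dim_{\mathrm H}$ denotes Hausdorff dimension. -/

import Mathlib

open Filter Topology

namespace CantorSeries

/-- `q : ℕ → ℕ` is a basic sequence: all its terms are at least `2`.
Sequences indexed by `1, 2, 3, …` on paper start at `0` here: `q n` stands for `q_{n+1}`. -/
def IsBasicSequence (q : ℕ → ℕ) : Prop := ∀ n, 2 ≤ q n

/-- `q` is infinite in limit: `q_n → ∞`. -/
def InfiniteInLimit (q : ℕ → ℕ) : Prop := Tendsto q atTop atTop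

/-- The product `q_1 q_2 ⋯ q_n` of the first `n` terms. -/
def partialProd (q : ℕ → ℕ) (n : ℕ) : ℕ := ∏ i ∈ Finset.range n, q i

/-- `x = E₀ + ∑_{n ≥ 1} E_n / (q_1 ⋯ q_n)` is the `Q`-Cantor series expansion of `x`
(`E n` stands for `E_{n+1}`): `E₀ = ⌊x⌋`, `E_n ∈ {0, …, q_n - 1}`, and `E_n ≠ q_n - 1`
for infinitely many `n`. -/
structure IsCantorExpansion (q : ℕ → ℕ) (x : ℝ) (E₀ : ℤ) (E : ℕ → ℕ) : Prop where
  floor_eq : E₀ = ⌊x⌋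
  lt : ∀ n, E n < q n
  frequently_ne : ∃ᶠ n in atTop, E n ≠ q n - 1
  hasSum : HasSum (fun n => (E n : ℝ) / (partialProd q (n + 1) : ℝ)) (x - E₀)

/-- `T_{Q,n}(x) = (q_1 ⋯ q_n) x (mod 1)`, for `n ≥ 0`. -/
noncomputable def T (q : ℕ → ℕ) (n : ℕ) (x : ℝ) : ℝ := Int.fract ((partialProd q n : ℝ) * x)

/-- The digits of the `Q`-Cantor series expansion of `x`: `digit q x n` is `E_{n+1}(x)`.
By `isCantorExpansion_iff` below these are the digits of the unique expansion of `x`. -/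
noncomputable def digit (q : ℕ → ℕ) (x : ℝ) (n : ℕ) : ℕ := ⌊(q n : ℝ) * T q n x⌋₊

lemma partialProd_succ (q : ℕ → ℕ) (n : ℕ) :
    partialProd q (n + 1) = partialProd q n * q n := Finset.prod_range_succ _ _

lemma two_pow_le_partialProd {q : ℕ → ℕ} (hq : IsBasicSequence q) (n : ℕ) :
    2 ^ n ≤ partialProd q n := by
  induction n with
  | zero => simp [partialProd]
  | succ n ih => rw [partialProd_succ, pow_succ]; exact Nat.mul_le_mul ih (hq n)

lemma partialProd_pos {q : ℕ → ℕ} (hq : IsBasicSequence q) (n : ℕ) :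
    (0 : ℝ) < partialProd q n := by
  exact_mod_cast lt_of_lt_of_le (by positivity) (two_pow_le_partialProd hq n)

lemma T_succ (q : ℕ → ℕ) (x : ℝ) (n : ℕ) :
    T q (n + 1) x = (q n : ℝ) * T q n x - digit q x n := by
  have h0 : 0 ≤ (q n : ℝ) * T q n x := mul_nonneg (by positivity) (Int.fract_nonneg _)
  have h1 : T q (n + 1) x = Int.fract ((q n : ℝ) * T q n x) := by
    unfold T
    rw [Int.fract_eq_fract]
    refine ⟨q n * ⌊(partialProd q n : ℝ) * x⌋, ?_⟩
    rw [partialProd_succ, Int.fract]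
    push_cast
    ring
  rw [h1, digit, Int.fract, natCast_floor_eq_intCast_floor h0]

lemma digit_lt {q : ℕ → ℕ} (hq : IsBasicSequence q) (x : ℝ) (n : ℕ) : digit q x n < q n := by
  have h2 : (0 : ℝ) < q n := by exact_mod_cast lt_of_lt_of_le (by norm_num) (hq n)
  have h1 : T q n x < 1 := Int.fract_lt_one _
  have h0 : 0 ≤ T q n x := Int.fract_nonneg _
  rw [digit, Nat.floor_lt (mul_nonneg h2.le h0)]
  nlinarith

/-- The digits `digit q x` form a Cantor series expansion of `x`. -/
theorem isCantorExpansion_digit {q : ℕ → ℕ} (hq : IsBasicSequence q) (x : ℝ) :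
    IsCantorExpansion q x ⌊x⌋ (digit q x) := by
  refine ⟨rfl, digit_lt hq x, ?_, ?_⟩
  · intro hcon
    simp only [ne_eq, not_not] at hcon
    obtain ⟨N, hN⟩ := eventually_atTop.1 hcon
    have hT : 0 < 1 - T q N x := sub_pos.2 (Int.fract_lt_one _)
    have key : ∀ m, 2 ^ m * (1 - T q N x) ≤ 1 - T q (N + m) x := by
      intro m
      induction m with
      | zero => simp
      | succ m ih =>
        have hd : (digit q x (N + m) : ℝ) = q (N + m) - 1 := by
          rw [hN (N + m) (by omega), Nat.cast_sub (by linarith [hq (N + m)])]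
          simp
        have h2 : (2 : ℝ) ≤ q (N + m) := by exact_mod_cast hq (N + m)
        have h3 : 0 < 1 - T q (N + m) x := sub_pos.2 (Int.fract_lt_one _)
        rw [← add_assoc, T_succ, hd, pow_succ]
        nlinarith
    obtain ⟨m, hm⟩ := pow_unbounded_of_one_lt (1 / (1 - T q N x)) (one_lt_two (α := ℝ))
    rw [div_lt_iff₀ hT] at hm
    have h0 : 0 ≤ T q (N + m) x := Int.fract_nonneg _
    linarith [key m]
  · have key : ∀ n, ∑ i ∈ Finset.range n, (digit q x i : ℝ) / (partialProd q (i + 1) : ℝ)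
        = (x - ⌊x⌋) - T q n x / partialProd q n := by
      intro n
      induction n with
      | zero => simp [T, partialProd]
      | succ n ih =>
        have hp := partialProd_pos hq n
        have h2 : (0 : ℝ) < q n := by exact_mod_cast lt_of_lt_of_le (by norm_num) (hq n)
        rw [Finset.sum_range_succ, ih, T_succ, partialProd_succ]
        push_cast
        field_simp
        ring
    rw [hasSum_iff_tendsto_nat_of_nonneg (fun i => by positivity)]
    simp_rw [key]
    have hlim : Tendsto (fun n => T q n x / (partialProd q n : ℝ)) atTop (𝓝 0) := by
      refine squeeze_zero (fun n => div_nonneg (Int.fract_nonneg _) (partialProd_pos hq n).le)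
        (fun n => ?_) (tendsto_pow_atTop_nhds_zero_of_lt_one (r := (1 / 2 : ℝ))
          (by norm_num) (by norm_num))
      rw [one_div, inv_pow, ← one_div]
      have h1 : T q n x < 1 := Int.fract_lt_one _
      have h2 : (2 : ℝ) ^ n ≤ partialProd q n := by exact_mod_cast two_pow_le_partialProd hq n
      exact div_le_div₀ zero_le_one h1.le (by positivity) h2
    simpa using hlim.const_sub (x - ⌊x⌋)

/-- Existence and uniqueness of the Cantor series expansion; its digits are `digit q x`. -/
theorem isCantorExpansion_iff {q : ℕ → ℕ} (hq : IsBasicSequence q) (x : ℝ) (E₀ : ℤ)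
    (E : ℕ → ℕ) : IsCantorExpansion q x E₀ E ↔ E₀ = ⌊x⌋ ∧ E = digit q x := by
  constructor
  swap
  · rintro ⟨rfl, rfl⟩
    exact isCantorExpansion_digit hq x
  intro h
  refine ⟨h.floor_eq, ?_⟩
  set S : ℕ → ℝ := fun n => partialProd q n *
    ((x - E₀) - ∑ i ∈ Finset.range n, (E i : ℝ) / (partialProd q (i + 1) : ℝ)) with hS
  have hstep : ∀ n, S (n + 1) = q n * S n - E n := by
    intro n
    have hp := partialProd_pos hq n
    have h2 : (0 : ℝ) < q n := by exact_mod_cast lt_of_lt_of_le (by norm_num) (hq n)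
    simp only [hS]
    rw [Finset.sum_range_succ, partialProd_succ]
    push_cast
    field_simp
    ring
  have hnn : ∀ n, 0 ≤ S n := fun n => mul_nonneg (partialProd_pos hq n).le
    (sub_nonneg.2 (sum_le_hasSum _ (fun i _ => by positivity) h.hasSum))
  have hE : ∀ n, (E n : ℝ) ≤ q n - 1 := by
    intro n
    have : E n + 1 ≤ q n := h.lt n
    have : (E n : ℝ) + 1 ≤ q n := by exact_mod_cast this
    linarith
  have hle : ∀ n, S n ≤ 1 := by
    have hsum : ∀ n m, ∑ i ∈ Finset.range (n + m), (E i : ℝ) / (partialProd q (i + 1) : ℝ)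
        ≤ ∑ i ∈ Finset.range n, (E i : ℝ) / (partialProd q (i + 1) : ℝ)
          + (1 / partialProd q n - 1 / partialProd q (n + m)) := by
      intro n m
      induction m with
      | zero => simp
      | succ m ih =>
        have hp := partialProd_pos hq (n + m)
        have h2 : (0 : ℝ) < q (n + m) := by
          exact_mod_cast lt_of_lt_of_le (by norm_num) (hq (n + m))
        rw [← add_assoc, Finset.sum_range_succ, partialProd_succ]
        push_cast
        have h3 : (E (n + m) : ℝ) / (partialProd q (n + m) * q (n + m))
            ≤ 1 / partialProd q (n + m) - 1 / (partialProd q (n + m) * q (n + m)) := by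
          have : (1 : ℝ) / partialProd q (n + m) - 1 / (partialProd q (n + m) * q (n + m))
              = (q (n + m) - 1) / (partialProd q (n + m) * q (n + m)) := by
            field_simp
          rw [this]
          exact div_le_div_of_nonneg_right (hE _) (by positivity)
        linarith
    intro n
    have hp := partialProd_pos hq n
    have hb : (x - E₀) ≤ ∑ i ∈ Finset.range n, (E i : ℝ) / (partialProd q (i + 1) : ℝ)
        + 1 / partialProd q n := by
      refine le_of_tendsto ((tendsto_add_atTop_iff_nat n).2 h.hasSum.tendsto_sum_nat)
        (Eventually.of_forall fun m => ?_)
      have h1 := hsum n m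
      have h2 : (0 : ℝ) ≤ 1 / partialProd q (n + m) := by positivity
      rw [add_comm m n]
      linarith
    have : S n ≤ partialProd q n * (1 / partialProd q n) :=
      mul_le_mul_of_nonneg_left (by linarith) hp.le
    rwa [mul_one_div_cancel hp.ne'] at this
  have hlt : ∀ n, S n < 1 := by
    intro n
    refine lt_of_le_of_ne (hle n) fun h1 => ?_
    have hall : ∀ m, S (n + m) = 1 ∧ (E (n + m) : ℝ) = q (n + m) - 1 := by
      have aux : ∀ k, S k = 1 → S (k + 1) = 1 ∧ (E k : ℝ) = q k - 1 := by
        intro k hk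
        have h2 := hstep k
        rw [hk] at h2
        have h3 := hle (k + 1)
        have h4 := hE k
        constructor <;> linarith
      intro m
      induction m with
      | zero => exact ⟨h1, (aux n h1).2⟩
      | succ m ih => exact ⟨(aux _ ih.1).1, (aux _ (aux _ ih.1).1).2⟩
    refine h.frequently_ne (eventually_atTop.2 ⟨n, fun k hk => ?_⟩)
    obtain ⟨m, rfl⟩ := Nat.exists_eq_add_of_le hk
    have h5 : (E (n + m) : ℝ) + 1 = q (n + m) := by linarith [(hall m).2]
    have h6 : E (n + m) + 1 = q (n + m) := by exact_mod_cast h5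
    simp only [ne_eq, not_not]
    omega
  have hdig : ∀ n, ⌊(q n : ℝ) * S n⌋₊ = E n := by
    intro n
    have h1 := hstep n
    have h2 := hnn (n + 1)
    have h3 := hlt (n + 1)
    rw [Nat.floor_eq_iff (mul_nonneg (by positivity) (hnn n))]
    constructor <;> linarith
  have hST : ∀ n, S n = T q n x := by
    intro n
    induction n with
    | zero => simp [hS, T, partialProd, h.floor_eq]
    | succ n ih => rw [hstep, T_succ, digit, ← ih, hdig]
  funext n
  rw [digit, ← hST, hdig]

/-- `N_n^Q(B, x)`: the number of occurrences of the block `B` of length `k` in the digit sequence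
`E_1(x), E_2(x), …` that start at one of the positions `1, …, n`. -/
noncomputable def blockCount (q : ℕ → ℕ) {k : ℕ} (B : Fin k → ℕ) (n : ℕ) (x : ℝ) : ℕ :=
  ((Finset.range n).filter fun i => ∀ j : Fin k, digit q x (i + j) = B j).card

/-- The set of numbers that are `Q`-ratio normal of order `k`: for all blocks `B₁`, `B₂` of
length `k` (of arbitrary non-negative integers) the ratio of their counts tends to `1`.
The limit forces `N_n^Q(B₂, x) ≠ 0` for all large `n`, since `0 / 0 = a / 0 = 0` here, so a number
for which some block never occurs is not in the set. -/
def ratioNormalOfOrder (q : ℕ → ℕ) (k : ℕ) : Set ℝ :=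
  {x | ∀ B₁ B₂ : Fin k → ℕ,
    Tendsto (fun n => (blockCount q B₁ n x : ℝ) / (blockCount q B₂ n x : ℝ)) atTop (𝓝 1)}

open Classical in
/-- `u` is uniformly distributed mod `1`: for `0 ≤ a < b ≤ 1`, the proportion of the first `N`
terms whose fractional part lies in `[a, b)` tends to `b - a`. -/
def UniformlyDistributedModOne (u : ℕ → ℝ) : Prop :=
  ∀ a b : ℝ, 0 ≤ a → a < b → b ≤ 1 →
    Tendsto (fun N : ℕ =>
      (((Finset.range N).filter fun n => Int.fract (u n) ∈ Set.Ico a b).card : ℝ) / (N : ℝ))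
      atTop (𝓝 (b - a))

/-- The set of `Q`-distribution normal numbers. -/
def distributionNormal (q : ℕ → ℕ) : Set ℝ :=
  {x | UniformlyDistributedModOne fun n => T q n x}

end CantorSeries

namespace CantorSeries

/-! Choose the digits at random: with `u_n` independent and uniform on `[0, 1)`, let `E_n = 1 +
⌊(q_n - 2) u_n⌋`. Three facts hold for the resulting number `x`. No digit is `0`, so blocks of zeros
never occur and ratio normality fails in every order (`notMem_ratioNormalOfOrder`). The orbit point
`T q n x` is within `2 / q_n` of `u_n`. By the strong law `(u_n)` is almost surely equidistributed,
and as `q_n → ∞` so is the orbit (`ae_spreadSum_mem_distributionNormal`). Each digit value has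
probability at most `3 / q_n`, so a cylinder of order `n` has mass at most `3 ^ n / (q_1 ⋯ q_n)`.
Since `q_n → ∞`, the factor `3 ^ n` is smaller than any positive power of `q_1 ⋯ q_n`, up to a
constant. So the law of `x` gives an interval of radius `δ` mass `O(δ ^ d)` for every `d < 1`
(`exists_map_spreadSum_Icc_le`). The law of `x` is thus carried by the set in question, and the mass
distribution principle (`le_dimH_of_measure_Icc_le`) gives dimension at least every `d < 1`. -/

/-! ### Numbers with prescribed digits -/

/-- The sum of the Cantor series with digit sequence `E`. -/
noncomputable def cantorSum (q : ℕ → ℕ) (E : ℕ → ℕ) : ℝ :=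
  ∑' n, (E n : ℝ) / (partialProd q (n + 1) : ℝ)

lemma q_pos {q : ℕ → ℕ} (hq : IsBasicSequence q) (n : ℕ) : (0 : ℝ) < q n := by
  exact_mod_cast lt_of_lt_of_le (by norm_num) (hq n)

lemma tendsto_partialProd {q : ℕ → ℕ} (hq : IsBasicSequence q) :
    Tendsto (fun n => (partialProd q n : ℝ)) atTop atTop := by
  refine tendsto_atTop_mono (fun n => ?_) (tendsto_pow_atTop_atTop_of_one_lt (one_lt_two (α := ℝ)))
  exact_mod_cast two_pow_le_partialProd hq n

/-- The series telescopes. It dominates every Cantor series, which yields summability and the upper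
bound `1`. -/
lemma hasSum_maximal_digits {q : ℕ → ℕ} (hq : IsBasicSequence q) :
    HasSum (fun n => ((q n : ℝ) - 1) / (partialProd q (n + 1) : ℝ)) 1 := by
  have h1 : ∀ n, (0 : ℝ) ≤ ((q n : ℝ) - 1) / (partialProd q (n + 1) : ℝ) := by
    intro n
    have : (2 : ℝ) ≤ q n := by exact_mod_cast hq n
    exact div_nonneg (by linarith) (partialProd_pos hq _).le
  have h2 : ∀ n, ((q n : ℝ) - 1) / (partialProd q (n + 1) : ℝ)
      = (partialProd q n : ℝ)⁻¹ - (partialProd q (n + 1) : ℝ)⁻¹ := by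
    intro n
    have hp := partialProd_pos hq n
    have hn := q_pos hq n
    rw [partialProd_succ]
    push_cast
    field_simp
  rw [hasSum_iff_tendsto_nat_of_nonneg h1]
  simp_rw [h2, Finset.sum_range_sub' (fun n => (partialProd q n : ℝ)⁻¹)]
  simpa [partialProd] using (tendsto_partialProd hq).inv_tendsto_atTop.const_sub 1

lemma digit_term_le {q E : ℕ → ℕ} (hq : IsBasicSequence q) (hE : ∀ n, E n < q n) (n : ℕ) :
    (E n : ℝ) / (partialProd q (n + 1) : ℝ) ≤ ((q n : ℝ) - 1) / (partialProd q (n + 1) : ℝ) := by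
  have : (E n : ℝ) + 1 ≤ q n := by exact_mod_cast hE n
  exact div_le_div_of_nonneg_right (by linarith) (partialProd_pos hq _).le

lemma summable_cantor {q E : ℕ → ℕ} (hq : IsBasicSequence q) (hE : ∀ n, E n < q n) :
    Summable fun n => (E n : ℝ) / (partialProd q (n + 1) : ℝ) :=
  .of_nonneg_of_le (fun _ => by positivity) (digit_term_le hq hE) (hasSum_maximal_digits hq).summable

lemma isCantorExpansion_cantorSum {q E : ℕ → ℕ} (hq : IsBasicSequence q) (hE : ∀ n, E n < q n)
    (hne : ∃ᶠ n in atTop, E n ≠ q n - 1) : IsCantorExpansion q (cantorSum q E) 0 E := by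
  have hs : HasSum (fun n => (E n : ℝ) / (partialProd q (n + 1) : ℝ)) (cantorSum q E) :=
    (summable_cantor hq hE).hasSum
  refine ⟨?_, hE, hne, by simpa using hs⟩
  obtain ⟨i, hi⟩ := hne.exists
  refine (Int.floor_eq_zero_iff.2 ⟨tsum_nonneg fun _ => by positivity, ?_⟩).symm
  refine hasSum_lt (digit_term_le hq hE) (i := i) ?_ hs (hasSum_maximal_digits hq)
  have : E i + 1 < q i := by have := hE i; omega
  have : (E i : ℝ) + 1 < q i := by exact_mod_cast this
  exact div_lt_div_of_pos_right (by linarith) (partialProd_pos hq _)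

lemma digit_cantorSum {q E : ℕ → ℕ} (hq : IsBasicSequence q) (hE : ∀ n, E n < q n)
    (hne : ∃ᶠ n in atTop, E n ≠ q n - 1) : digit q (cantorSum q E) = E :=
  (((isCantorExpansion_iff hq _ _ _).1 (isCantorExpansion_cantorSum hq hE hne)).2).symm

lemma floor_partialProd_succ_mul (q : ℕ → ℕ) (x : ℝ) (n : ℕ) :
    ⌊(partialProd q (n + 1) : ℝ) * x⌋ = q n * ⌊(partialProd q n : ℝ) * x⌋ + digit q x n := by
  have h := T_succ q x n
  have h1 : (0 : ℝ) ≤ T q (n + 1) x := Int.fract_nonneg _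
  have h2 : T q (n + 1) x < 1 := Int.fract_lt_one _
  have h3 : T q n x = partialProd q n * x - ⌊(partialProd q n : ℝ) * x⌋ := rfl
  rw [Int.floor_eq_iff, partialProd_succ]
  push_cast
  constructor <;> nlinarith

/-- The integer part of `q_1 ⋯ q_n x` determines the first `n` digits of `x`. -/
lemma digit_eq_of_floor_eq {q : ℕ → ℕ} (hq : IsBasicSequence q) {x y : ℝ} {n : ℕ}
    (h : ⌊(partialProd q n : ℝ) * x⌋ = ⌊(partialProd q n : ℝ) * y⌋) :
    ∀ i < n, digit q x i = digit q y i := by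
  induction n with
  | zero => intro i hi; omega
  | succ n ih =>
    rw [floor_partialProd_succ_mul, floor_partialProd_succ_mul] at h
    have hx := digit_lt hq x n
    have hy := digit_lt hq y n
    have hd : digit q x n = digit q y n := by
      -- Reduction mod `q n` isolates the last digit.
      have := congrArg (· % (q n : ℤ)) h
      simp only [Int.mul_add_emod_self_left] at this
      rw [Int.emod_eq_of_lt (by omega) (by omega), Int.emod_eq_of_lt (by omega) (by omega)] at this
      exact_mod_cast this
    have hf : ⌊(partialProd q n : ℝ) * x⌋ = ⌊(partialProd q n : ℝ) * y⌋ := by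
      have hq0 : (q n : ℤ) ≠ 0 := by have := hq n; omega
      rw [hd] at h
      exact mul_left_cancel₀ hq0 (add_right_cancel h)
    intro i hi
    rcases Nat.lt_succ_iff_lt_or_eq.1 hi with hi | rfl
    · exact ih hf i hi
    · exact hd

/-- A number none of whose digits is `0` is not ratio normal of any order. -/
lemma notMem_ratioNormalOfOrder {q : ℕ → ℕ} {x : ℝ} (h : ∀ n, digit q x n ≠ 0) {k : ℕ}
    (hk : 1 ≤ k) : x ∉ ratioNormalOfOrder q k := by
  intro hx
  have h0 : ∀ n, blockCount q (fun _ : Fin k => 0) n x = 0 := fun n => by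
    rw [blockCount, Finset.card_eq_zero, Finset.filter_eq_empty_iff]
    exact fun i _ hi => h _ (hi ⟨0, hk⟩)
  -- The zero block against itself has ratio `0 / 0 = 0` for every `n`, which cannot tend to `1`.
  have := hx (fun _ => 0) (fun _ => 0)
  simp only [h0, Nat.cast_zero, zero_div] at this
  exact zero_ne_one (tendsto_nhds_unique tendsto_const_nhds this)

/-- If `q_n → ∞` then, for fixed `ε > 0`, `q_1 ⋯ q_n` to the power `ε` outgrows `3 ^ n`. -/
lemma exists_three_pow_le {q : ℕ → ℕ} (hq : IsBasicSequence q) (hlim : InfiniteInLimit q)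
    {ε : ℝ} (hε : 0 < ε) :
    ∃ C : ℝ, 0 < C ∧ ∀ n, (3 : ℝ) ^ n ≤ C * (partialProd q n : ℝ) ^ ε := by
  have ht : Tendsto (fun n => (q n : ℝ) ^ ε) atTop atTop :=
    (tendsto_rpow_atTop hε).comp (tendsto_natCast_atTop_atTop.comp hlim)
  obtain ⟨N, hN⟩ := eventually_atTop.1 (ht.eventually_ge_atTop 3)
  -- From index `N` on, each new factor `q n ^ ε` absorbs a factor `3`; the constant pays for the
  -- first `N` steps.
  refine ⟨3 ^ N, by positivity, fun n => ?_⟩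
  have h1 : ∀ n, (1 : ℝ) ≤ (partialProd q n : ℝ) ^ ε := fun n => by
    refine Real.one_le_rpow ?_ hε.le
    exact_mod_cast (Nat.one_le_two_pow).trans (two_pow_le_partialProd hq n)
  induction n with
  | zero =>
    have : (1 : ℝ) ≤ 3 ^ N := one_le_pow₀ (by norm_num)
    nlinarith [h1 0]
  | succ n ih =>
    by_cases hn : N ≤ n
    · rw [partialProd_succ, pow_succ]
      push_cast
      rw [Real.mul_rpow (by positivity) (by positivity), ← mul_assoc]
      exact mul_le_mul ih (hN n hn) (by norm_num) (by positivity)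
    · have : (3 : ℝ) ^ (n + 1) ≤ 3 ^ N := pow_le_pow_right₀ (by norm_num) (by omega)
      nlinarith [h1 (n + 1), pow_pos (three_pos (α := ℝ)) N]

/-! ### Limiting frequencies and uniform distribution -/

open Classical in
/-- The proportion of the first `N` terms of `u` that are smaller than `t`. -/
noncomputable def freqLT (u : ℕ → ℝ) (t : ℝ) (N : ℕ) : ℝ :=
  (((Finset.range N).filter fun n => u n < t).card : ℝ) / (N : ℝ)

open Classical in
lemma exists_card_filter_le {P R : ℕ → Prop} (h : ∀ᶠ n in atTop, P n → R n) :
    ∃ M : ℕ, ∀ N, ((Finset.range N).filter P).card ≤ ((Finset.range N).filter R).card + M := by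
  obtain ⟨M, hM⟩ := eventually_atTop.1 h
  refine ⟨M, fun N => ?_⟩
  have hsub : (Finset.range N).filter P ⊆ (Finset.range N).filter R ∪ Finset.range M := by
    intro n hn
    simp only [Finset.mem_filter, Finset.mem_union, Finset.mem_range] at hn ⊢
    by_cases hnM : n < M
    · exact Or.inr hnM
    · exact Or.inl ⟨hn.1, hM n (not_lt.1 hnM) hn.2⟩
  calc _ ≤ _ := Finset.card_le_card hsub
    _ ≤ _ := Finset.card_union_le _ _
    _ = _ := by rw [Finset.card_range]

lemma exists_freqLT_le {u v : ℕ → ℝ} {s t : ℝ} (h : ∀ᶠ n in atTop, u n < s → v n < t) :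
    ∃ M : ℕ, ∀ N : ℕ, freqLT u s N ≤ freqLT v t N + (M : ℝ) / N := by
  obtain ⟨M, hM⟩ := exists_card_filter_le h
  refine ⟨M, fun N => ?_⟩
  rw [freqLT, freqLT, ← add_div]
  exact div_le_div_of_nonneg_right (by exact_mod_cast hM N) (Nat.cast_nonneg N)

/-- Limiting frequencies below rational points pass to a sequence at distance tending to `0`. -/
lemma tendsto_freqLT_of_tendsto_sub {u v : ℕ → ℝ} (hv : ∀ n, v n ∈ Set.Ico (0 : ℝ) 1)
    (huv : Tendsto (fun n => v n - u n) atTop (𝓝 0))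
    (hu : ∀ r : ℚ, 0 ≤ (r : ℝ) → (r : ℝ) ≤ 1 → Tendsto (freqLT u r) atTop (𝓝 (r : ℝ)))
    {t : ℝ} (h0 : 0 ≤ t) (h1 : t ≤ 1) : Tendsto (freqLT v t) atTop (𝓝 t) := by
  have hM : ∀ M : ℕ, Tendsto (fun N : ℕ => (M : ℝ) / N) atTop (𝓝 0) :=
    fun M => tendsto_const_div_atTop_nhds_zero_nat _
  have hclose : ∀ δ > 0, ∀ᶠ n in atTop, |v n - u n| < δ := fun δ hδ => by
    simpa using huv.eventually (Metric.ball_mem_nhds 0 hδ)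
  -- At `t = 0` and `t = 1` the frequency is eventually constant because `v` lies in `[0, 1)`. Only
  -- interior points leave room for rationals of `[0, 1]` on both sides.
  rcases h0.eq_or_lt with rfl | h0
  · refine tendsto_const_nhds.congr fun N => ?_
    rw [freqLT, Finset.filter_eq_empty_iff.2 fun n _ => not_lt.2 (hv n).1]
    simp
  rcases h1.eq_or_lt with rfl | h1
  · refine (tendsto_const_nhds (x := (1 : ℝ))).congr' ?_
    filter_upwards [eventually_gt_atTop 0] with N hN
    rw [freqLT, Finset.filter_true_of_mem fun n _ => (hv n).2, Finset.card_range, div_self]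
    exact_mod_cast hN.ne'
  refine tendsto_order.2 ⟨fun a ha => ?_, fun a ha => ?_⟩
  · obtain ⟨r, hr, hrt⟩ := exists_rat_btwn (max_lt ha h0)
    obtain ⟨har, h0r⟩ := max_lt_iff.1 hr
    obtain ⟨M, hMle⟩ := exists_freqLT_le (u := u) (v := v) (s := r) (t := t) (by
      filter_upwards [hclose (t - r) (sub_pos.2 hrt)] with n hn hun
      linarith [(abs_lt.1 hn).2])
    have hlim := (hu r h0r.le (by linarith)).sub (hM M)
    rw [sub_zero] at hlim
    filter_upwards [hlim.eventually_const_lt har] with N hN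
    linarith [hMle N]
  · obtain ⟨r, htr, hr⟩ := exists_rat_btwn (lt_min ha h1)
    obtain ⟨hra, hr1⟩ := lt_min_iff.1 hr
    obtain ⟨M, hMle⟩ := exists_freqLT_le (u := v) (v := u) (s := t) (t := r) (by
      filter_upwards [hclose (r - t) (sub_pos.2 htr)] with n hn hun
      linarith [(abs_lt.1 hn).1])
    have hlim := (hu r (by linarith) hr1.le).add (hM M)
    rw [add_zero] at hlim
    filter_upwards [hlim.eventually_lt_const hra] with N hN
    linarith [hMle N]

lemma uniformlyDistributedModOne_of_freqLT {v : ℕ → ℝ} (hv : ∀ n, v n ∈ Set.Ico (0 : ℝ) 1)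
    (h : ∀ t : ℝ, 0 ≤ t → t ≤ 1 → Tendsto (freqLT v t) atTop (𝓝 t)) :
    UniformlyDistributedModOne v := by
  classical
  intro a b ha hab hb
  refine ((h b (by linarith) hb).sub (h a ha (by linarith))).congr fun N => ?_
  rw [freqLT, freqLT, ← sub_div]
  congr 1
  have hf : ∀ n, Int.fract (v n) = v n := fun n => Int.fract_eq_self.2 (hv n)
  have hsub : (Finset.range N).filter (fun n => v n < a) ⊆
      (Finset.range N).filter (fun n => v n < b) :=
    Finset.monotone_filter_right _ fun n _ hn => lt_trans hn hab
  rw [← Nat.cast_sub (Finset.card_le_card hsub), ← Finset.card_sdiff_of_subset hsub]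
  congr 2
  ext n
  simp only [Finset.mem_sdiff, Finset.mem_filter, Set.mem_Ico, hf]
  constructor
  · rintro ⟨⟨h1, h2⟩, h3⟩
    exact ⟨h1, not_lt.1 fun h4 => h3 ⟨h1, h4⟩, h2⟩
  · rintro ⟨h1, h2, h3⟩
    exact ⟨⟨h1, h3⟩, fun h4 => absurd h4.2 (not_lt.2 h2)⟩

/-! ### Independent uniform variables -/

open MeasureTheory ProbabilityTheory

/-- The uniform distribution on `[0, 1)`. -/
noncomputable def unif : Measure ℝ := volume.restrict (Set.Ico 0 1)

instance : IsProbabilityMeasure unif := ⟨by simp [unif]⟩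

/-- The law of a sequence of independent random variables, uniform on `[0, 1)`. -/
noncomputable def iidUnif : Measure (ℕ → ℝ) := Measure.infinitePi fun _ => unif

instance : IsProbabilityMeasure iidUnif := inferInstanceAs (IsProbabilityMeasure (Measure.infinitePi _))

lemma unif_fract_lt {r : ℝ} (h1 : r ≤ 1) :
    unif {x | Int.fract x < r} = ENNReal.ofReal r := by
  have hm : MeasurableSet {x : ℝ | Int.fract x < r} := measurable_fract measurableSet_Iio
  rw [unif, Measure.restrict_apply hm]
  have : {x : ℝ | Int.fract x < r} ∩ Set.Ico 0 1 = Set.Ico 0 r := by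
    ext x
    simp only [Set.mem_inter_iff, Set.mem_ofPred_eq, Set.mem_Ico]
    constructor
    · rintro ⟨h, hx⟩
      rw [Int.fract_eq_self.2 hx] at h
      exact ⟨hx.1, h⟩
    · rintro ⟨h, hx⟩
      rw [Int.fract_eq_self.2 ⟨h, by linarith⟩]
      exact ⟨hx, h, by linarith⟩
  rw [this, Real.volume_Ico, sub_zero]

/-- The strong law of large numbers, applied to the indicators of `Int.fract (ω n) < r`, whose mean
is `r`. -/
lemma ae_tendsto_freqLT {r : ℝ} (h0 : 0 ≤ r) (h1 : r ≤ 1) :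
    ∀ᵐ ω ∂iidUnif, Tendsto (freqLT (fun n => Int.fract (ω n)) r) atTop (𝓝 r) := by
  classical
  set S : Set ℝ := {x | Int.fract x < r} with hS
  have hm : MeasurableSet S := measurable_fract measurableSet_Iio
  set f : ℝ → ℝ := S.indicator 1 with hf
  have hfm : Measurable f := measurable_one.indicator hm
  have hev : ∀ i : ℕ, iidUnif.map (fun ω => ω i) = unif := fun i =>
    Measure.infinitePi_map_eval _ i
  have hint : Integrable (fun ω : ℕ → ℝ => f (ω 0)) iidUnif := by
    refine Integrable.of_bound (C := 1) (hfm.comp (measurable_pi_apply 0)).aestronglyMeasurable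
      (ae_of_all _ fun ω => ?_)
    simp only [hf, Set.indicator_apply]
    split_ifs <;> simp
  have hindep : iIndepFun (fun (i : ℕ) (ω : ℕ → ℝ) => f (ω i)) iidUnif :=
    iIndepFun_infinitePi fun _ => hfm
  have hid : ∀ i : ℕ, IdentDistrib (fun ω : ℕ → ℝ => f (ω i)) (fun ω => f (ω 0))
      iidUnif iidUnif := fun i =>
    IdentDistrib.comp (f := fun ω : ℕ → ℝ => ω i) (g := fun ω : ℕ → ℝ => ω 0)
      ⟨(measurable_pi_apply i).aemeasurable, (measurable_pi_apply 0).aemeasurable,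
        by rw [hev, hev]⟩ hfm
  have hmean : ∫ ω, f (ω 0) ∂iidUnif = r := by
    rw [← integral_map (φ := fun ω : ℕ → ℝ => ω 0) (measurable_pi_apply 0).aemeasurable
      hfm.aestronglyMeasurable, hev, hf, integral_indicator_one hm, Measure.real, hS,
      unif_fract_lt h1, ENNReal.toReal_ofReal h0]
  have := strong_law_ae_real (fun (i : ℕ) (ω : ℕ → ℝ) => f (ω i)) hint
    (fun i j hij => hindep.indepFun hij) hid
  rw [hmean] at this
  filter_upwards [this] with ω hω
  refine hω.congr fun N => ?_
  rw [freqLT]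
  congr 1
  simp [hf, hS, Set.indicator_apply]

/-! ### Mass distribution principle -/

open MeasureTheory ProbabilityTheory ENNReal

/-- Mass distribution principle on the real line. -/
lemma le_dimH_of_measure_Icc_le {ν : Measure ℝ} {K : ℝ} {d : NNReal} (hK : 0 < K)
    (h : ∀ x δ : ℝ, 0 < δ → δ ≤ 1 → ν (Set.Icc (x - δ) (x + δ)) ≤ ENNReal.ofReal (K * δ ^ (d : ℝ)))
    {A : Set ℝ} (hA : ν A ≠ 0) : (d : ℝ≥0∞) ≤ dimH A := by
  have hbound : ∀ s : Set ℝ, Metric.ediam s ≤ 1 →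
      ν s ≤ ENNReal.ofReal K * Metric.ediam s ^ (d : ℝ) := by
    intro s hs
    rcases s.eq_empty_or_nonempty with rfl | ⟨x, hx⟩
    · simp
    have htop : Metric.ediam s ≠ ∞ := ne_top_of_le_ne_top one_ne_top hs
    set δ := (Metric.ediam s).toReal with hδ
    have hδe : Metric.ediam s = ENNReal.ofReal δ := (ofReal_toReal htop).symm
    have hδ0 : 0 ≤ δ := toReal_nonneg
    have hδ1 : δ ≤ 1 := by simpa using toReal_mono one_ne_top hs
    have hsub : ∀ η, δ ≤ η → s ⊆ Set.Icc (x - η) (x + η) := by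
      intro η hη y hy
      have h1 : edist y x ≤ ENNReal.ofReal δ := hδe ▸ Metric.edist_le_ediam_of_mem hy hx
      rw [edist_dist, ofReal_le_ofReal_iff hδ0, Real.dist_eq] at h1
      have := abs_le.1 h1
      constructor <;> linarith
    rw [hδe, ofReal_rpow_of_nonneg hδ0 (NNReal.coe_nonneg d), ← ofReal_mul hK.le]
    rcases hδ0.eq_or_lt with h0 | h0
    -- The hypothesis covers positive radii only, so for diameter `0` the radius `η` is sent to `0`.
    · have hlim : Tendsto (fun η : ℝ => ENNReal.ofReal (K * η ^ (d : ℝ))) (𝓝[>] 0)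
          (𝓝 (ENNReal.ofReal (K * (0 : ℝ) ^ (d : ℝ)))) := by
        refine ENNReal.tendsto_ofReal (Tendsto.const_mul _ ?_)
        exact ((Real.continuousAt_rpow_const _ _ (Or.inr (NNReal.coe_nonneg d))).tendsto).mono_left
          nhdsWithin_le_nhds
      rw [← h0]
      refine ge_of_tendsto hlim ?_
      filter_upwards [Ioo_mem_nhdsGT one_pos] with η hη
      exact (measure_mono (hsub η (by linarith [hη.1]))).trans (h x η hη.1 hη.2.le)
    · exact (measure_mono (hsub δ le_rfl)).trans (h x δ h0 hδ1)
  have hK0 : ENNReal.ofReal K ≠ 0 := by simpa using hK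
  have hle : (ENNReal.ofReal K)⁻¹ • ν ≤ Measure.hausdorffMeasure (d : ℝ) := by
    refine Measure.le_hausdorffMeasure _ _ 1 one_pos fun s hs => ?_
    rw [Measure.smul_apply, smul_eq_mul, mul_comm, ← div_eq_mul_inv]
    exact ENNReal.div_le_of_le_mul' (hbound s hs)
  refine le_dimH_of_hausdorffMeasure_ne_zero fun h0 => hA ?_
  have h1 := hle A
  rw [h0, Measure.smul_apply, smul_eq_mul, nonpos_iff_eq_zero, mul_eq_zero] at h1
  exact h1.resolve_left (ENNReal.inv_ne_zero.2 ofReal_ne_top)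

/-! ### Random digits avoiding zero -/

/-- A digit in base `m`, between `1` and `m - 2` if `m ≥ 3`, spread evenly over the unit
interval. -/
noncomputable def spreadDigit (m : ℕ) (u : ℝ) : ℕ := 1 + ⌊((m - 2 : ℕ) : ℝ) * Int.fract u⌋₊

lemma measurable_spreadDigit (m : ℕ) : Measurable (spreadDigit m) :=
  (Nat.measurable_floor.comp (measurable_fract.const_mul _)).const_add 1

lemma spreadDigit_lt {m : ℕ} (hm : 2 ≤ m) (u : ℝ) : spreadDigit m u < m := by
  have : ⌊((m - 2 : ℕ) : ℝ) * Int.fract u⌋₊ ≤ m - 2 := by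
    refine Nat.floor_le_of_le ?_
    nlinarith [Int.fract_nonneg u, Int.fract_lt_one u, Nat.cast_nonneg (α := ℝ) (m - 2)]
  rw [spreadDigit]
  omega

lemma spreadDigit_ne {m : ℕ} (hm : 3 ≤ m) (u : ℝ) : spreadDigit m u ≠ m - 1 := by
  have : ⌊((m - 2 : ℕ) : ℝ) * Int.fract u⌋₊ < m - 2 := by
    rw [Nat.floor_lt (mul_nonneg (Nat.cast_nonneg _) (Int.fract_nonneg _))]
    have : (0 : ℝ) < (m - 2 : ℕ) := by exact_mod_cast (by omega : 0 < m - 2)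
    nlinarith [Int.fract_lt_one u]
  rw [spreadDigit]
  omega

lemma unif_spreadDigit_le {m : ℕ} (hm : 2 ≤ m) (d : ℕ) :
    unif {u | spreadDigit m u = d} ≤ ENNReal.ofReal (3 / m) := by
  rcases hm.eq_or_lt with rfl | hm
  · refine prob_le_one.trans ?_
    rw [one_le_ofReal]
    norm_num
  have hmeas : MeasurableSet {u | spreadDigit m u = d} :=
    measurable_spreadDigit m (measurableSet_singleton d)
  have hk : (0 : ℝ) < (m - 2 : ℕ) := by exact_mod_cast (by omega : 0 < m - 2)
  have hsub : {u | spreadDigit m u = d} ∩ Set.Ico 0 1 ⊆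
      Set.Ico (((d : ℝ) - 1) / (m - 2 : ℕ)) ((d : ℝ) / (m - 2 : ℕ)) := by
    rintro u ⟨hu, hu1⟩
    have hu : spreadDigit m u = d := hu
    rw [spreadDigit, Int.fract_eq_self.2 hu1] at hu
    have h1 := Nat.floor_le (mul_nonneg hk.le hu1.1)
    have h2 := Nat.lt_floor_add_one (((m - 2 : ℕ) : ℝ) * u)
    rw [← hu]
    push_cast
    rw [Set.mem_Ico, div_le_iff₀ hk, lt_div_iff₀ hk]
    constructor <;> linarith
  rw [unif, Measure.restrict_apply hmeas]
  refine (measure_mono hsub).trans ?_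
  rw [Real.volume_Ico]
  refine ofReal_le_ofReal ?_
  have hm0 : (0 : ℝ) < m := by exact_mod_cast (by omega : 0 < m)
  rw [← sub_div, show (d : ℝ) - (d - 1) = 1 by ring, div_le_div_iff₀ hk hm0]
  -- A digit value has mass at most `1 / (m - 2)`; the constant `3` is forced by `m = 3`.
  exact_mod_cast (by omega : 1 * m ≤ 3 * (m - 2))

/-- The number whose `n`-th digit is the spread digit given by the `n`-th term of `ω`. -/
noncomputable def spreadSum (q : ℕ → ℕ) (ω : ℕ → ℝ) : ℝ :=
  cantorSum q fun n => spreadDigit (q n) (ω n)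

lemma measurable_spreadSum (q : ℕ → ℕ) : Measurable (spreadSum q) := by
  refine Measurable.tsum fun n => Measurable.div_const ?_ _
  exact measurable_from_top.comp ((measurable_spreadDigit (q n)).comp (measurable_pi_apply n))

variable {q : ℕ → ℕ}

lemma digit_spreadSum (hq : IsBasicSequence q) (hlim : InfiniteInLimit q) (ω : ℕ → ℝ) (n : ℕ) :
    digit q (spreadSum q ω) n = spreadDigit (q n) (ω n) :=
  congrFun (digit_cantorSum hq (fun n => spreadDigit_lt (hq n) (ω n))
    ((hlim.eventually_ge_atTop 3).mono fun n hn => spreadDigit_ne hn (ω n)).frequently) n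

/-! ### Mass of cylinders and intervals -/

lemma iidUnif_cylinder_le (hq : IsBasicSequence q) (hlim : InfiniteInLimit q) (n : ℕ) (m : ℤ) :
    iidUnif {ω | ⌊(partialProd q n : ℝ) * spreadSum q ω⌋ = m} ≤
      ENNReal.ofReal (3 ^ n / partialProd q n) := by
  rcases Set.eq_empty_or_nonempty {ω | ⌊(partialProd q n : ℝ) * spreadSum q ω⌋ = m}
    with h | ⟨ω₀, hω₀⟩
  · simp [h]
  have hω₀ : ⌊(partialProd q n : ℝ) * spreadSum q ω₀⌋ = m := hω₀
  have hsub : {ω | ⌊(partialProd q n : ℝ) * spreadSum q ω⌋ = m} ⊆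
      (Finset.range n : Set ℕ).pi
        fun i => {u | spreadDigit (q i) u = spreadDigit (q i) (ω₀ i)} := by
    intro ω hω i hi
    have hω : ⌊(partialProd q n : ℝ) * spreadSum q ω⌋ = m := hω
    have := digit_eq_of_floor_eq hq (hω.trans hω₀.symm) i (by simpa using hi)
    rwa [digit_spreadSum hq hlim, digit_spreadSum hq hlim] at this
  calc _ ≤ _ := measure_mono hsub
    _ = _ := Measure.infinitePi_pi _ fun i _ =>
      measurable_spreadDigit (q i) (measurableSet_singleton _)
    _ ≤ ∏ i ∈ Finset.range n, ENNReal.ofReal (3 / q i) :=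
      Finset.prod_le_prod' fun i _ => unif_spreadDigit_le (hq i) _
    _ = _ := by
      rw [← ofReal_prod_of_nonneg fun i _ => by positivity, Finset.prod_div_distrib]
      simp [partialProd]

/-- The interval meets at most `P (b - a) + 2` cylinders of order `n`, where `P = q_1 ⋯ q_n`. -/
lemma iidUnif_preimage_Icc_le (hq : IsBasicSequence q) (hlim : InfiniteInLimit q) (n : ℕ)
    {a b : ℝ} (hab : a ≤ b) :
    iidUnif (spreadSum q ⁻¹' Set.Icc a b) ≤
      ENNReal.ofReal ((partialProd q n * (b - a) + 2) * (3 ^ n / partialProd q n)) := by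
  set P : ℝ := (partialProd q n : ℝ) with hP
  have hP0 : 0 < P := partialProd_pos hq n
  have hsub : spreadSum q ⁻¹' Set.Icc a b ⊆
      ⋃ m ∈ Finset.Icc ⌊P * a⌋ ⌊P * b⌋, {ω | ⌊P * spreadSum q ω⌋ = m} := by
    intro ω hω
    simp only [Set.mem_iUnion, Finset.mem_Icc]
    exact ⟨_, ⟨Int.floor_le_floor (mul_le_mul_of_nonneg_left hω.1 hP0.le),
      Int.floor_le_floor (mul_le_mul_of_nonneg_left hω.2 hP0.le)⟩, rfl⟩
  have hcard : ((Finset.Icc ⌊P * a⌋ ⌊P * b⌋).card : ℝ) ≤ P * (b - a) + 2 := by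
    have hfl : ⌊P * a⌋ ≤ ⌊P * b⌋ := Int.floor_le_floor (mul_le_mul_of_nonneg_left hab hP0.le)
    have : (((Finset.Icc ⌊P * a⌋ ⌊P * b⌋).card : ℤ) : ℝ) = ⌊P * b⌋ + 1 - ⌊P * a⌋ := by
      rw [Int.card_Icc, Int.toNat_of_nonneg (by omega)]
      push_cast
      ring
    rw [Int.cast_natCast] at this
    rw [this]
    nlinarith [Int.floor_le (P * b), Int.lt_floor_add_one (P * a)]
  calc _ ≤ _ := measure_mono hsub
    _ ≤ ∑ m ∈ Finset.Icc ⌊P * a⌋ ⌊P * b⌋, iidUnif {ω | ⌊P * spreadSum q ω⌋ = m} :=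
      measure_biUnion_finset_le _ _
    _ ≤ ∑ m ∈ Finset.Icc ⌊P * a⌋ ⌊P * b⌋, ENNReal.ofReal (3 ^ n / P) :=
      Finset.sum_le_sum fun m _ => iidUnif_cylinder_le hq hlim n m
    _ = ENNReal.ofReal ((Finset.Icc ⌊P * a⌋ ⌊P * b⌋).card * (3 ^ n / P)) := by
      rw [Finset.sum_const, nsmul_eq_mul, ofReal_mul (Nat.cast_nonneg _), ofReal_natCast]
    _ ≤ _ := ofReal_le_ofReal (mul_le_mul_of_nonneg_right hcard (by positivity))

lemma exists_map_spreadSum_Icc_le (hq : IsBasicSequence q) (hlim : InfiniteInLimit q) {d : ℝ}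
    (hd : d < 1) : ∃ K : ℝ, 0 < K ∧ ∀ x δ : ℝ, 0 < δ → δ ≤ 1 →
      iidUnif.map (spreadSum q) (Set.Icc (x - δ) (x + δ)) ≤ ENNReal.ofReal (K * δ ^ d) := by
  obtain ⟨C, hC, hCle⟩ := exists_three_pow_le hq hlim (sub_pos.2 hd)
  refine ⟨12 * C, by positivity, fun x δ hδ hδ1 => ?_⟩
  have hex : ∃ n, 1 ≤ δ * partialProd q (n + 1) :=
    (((tendsto_add_atTop_iff_nat 1).2 (tendsto_partialProd hq)).const_mul_atTop
      hδ |>.eventually_ge_atTop 1).exists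
  -- The scale is chosen so that `1 / δ` lies between consecutive partial products. Cylinders of
  -- order `n + 1` are counted, while `3 ^ n` is compared with the product of order `n`, so the
  -- possibly huge factor `q n` cancels.
  obtain ⟨n, h1, h2⟩ : ∃ n, 1 ≤ δ * partialProd q (n + 1) ∧ δ * partialProd q n ≤ 1 := by
    classical
    refine ⟨Nat.find hex, Nat.find_spec hex, ?_⟩
    rcases h : Nat.find hex with _ | k
    · simpa [partialProd] using hδ1
    · exact (not_le.1 (Nat.find_min hex (m := k) (by omega))).le
  rw [Measure.map_apply (measurable_spreadSum q) measurableSet_Icc]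
  refine (iidUnif_preimage_Icc_le hq hlim (n + 1) (by linarith)).trans (ofReal_le_ofReal ?_)
  have hP := partialProd_pos hq n
  have hP1 := partialProd_pos hq (n + 1)
  have h3 : (partialProd q n : ℝ) ^ (1 - d) ≤ δ ^ (d - 1) := by
    have h4 : (partialProd q n : ℝ) ≤ δ⁻¹ := by
      rw [← one_div, le_div_iff₀ hδ]
      linarith
    calc _ ≤ δ⁻¹ ^ (1 - d) := Real.rpow_le_rpow hP.le h4 (by linarith)
      _ = δ ^ (d - 1) := by rw [Real.inv_rpow hδ.le, ← Real.rpow_neg hδ.le, neg_sub]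
  -- The interval has length `2 δ`, and the additive `2` is at most `2 δ * partialProd q (n + 1)`.
  calc _ ≤ (4 * (δ * partialProd q (n + 1))) * (3 ^ (n + 1) / partialProd q (n + 1)) := by
        refine mul_le_mul_of_nonneg_right ?_ (by positivity)
        nlinarith
    _ = 12 * 3 ^ n * δ := by field_simp; ring
    _ ≤ 12 * (C * δ ^ (d - 1)) * δ := by
        have := (hCle n).trans (mul_le_mul_of_nonneg_left h3 hC.le)
        gcongr
    _ = 12 * C * δ ^ d := by
        rw [Real.rpow_sub_one hδ.ne']
        field_simp

/-! ### Equidistribution of the orbit -/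

lemma tendsto_T_spreadSum_sub (hq : IsBasicSequence q) (hlim : InfiniteInLimit q) (ω : ℕ → ℝ) :
    Tendsto (fun n => T q n (spreadSum q ω) - Int.fract (ω n)) atTop (𝓝 0) := by
  have hlim' : Tendsto (fun n => (2 : ℝ) / q n) atTop (𝓝 0) :=
    (tendsto_natCast_atTop_atTop.comp hlim).const_div_atTop 2
  refine squeeze_zero_norm (fun n => ?_) hlim'
  have h := T_succ q (spreadSum q ω) n
  have h1 : (0 : ℝ) ≤ T q (n + 1) (spreadSum q ω) := Int.fract_nonneg _
  have h2 : T q (n + 1) (spreadSum q ω) < 1 := Int.fract_lt_one _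
  have hu0 := Int.fract_nonneg (ω n)
  have hu1 := Int.fract_lt_one (ω n)
  have hcast : ((q n - 2 : ℕ) : ℝ) = q n - 2 := by
    rw [Nat.cast_sub (hq n)]
    norm_num
  have hnn : 0 ≤ ((q n : ℝ) - 2) * Int.fract (ω n) := by
    rw [← hcast]
    positivity
  have h3 := Nat.floor_le hnn
  have h4 := Nat.lt_floor_add_one (((q n : ℝ) - 2) * Int.fract (ω n))
  rw [digit_spreadSum hq hlim, spreadDigit, hcast] at h
  push_cast at h
  rw [Real.norm_eq_abs, le_div_iff₀ (q_pos hq n), ← abs_of_pos (q_pos hq n), ← abs_mul, abs_le]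
  -- With `u = Int.fract (ω n)` and `θ` the fractional part of `(q n - 2) u`, the quantity bounded
  -- is `1 - θ - 2 u + T q (n + 1) x`, which lies in `(-2, 2)`.
  constructor <;> nlinarith

lemma ae_spreadSum_mem_distributionNormal (hq : IsBasicSequence q) (hlim : InfiniteInLimit q) :
    ∀ᵐ ω ∂iidUnif, spreadSum q ω ∈ distributionNormal q := by
  -- Rational thresholds suffice, so only countably many null sets are discarded.
  have h : ∀ᵐ ω ∂iidUnif, ∀ r : ℚ, 0 ≤ (r : ℝ) → (r : ℝ) ≤ 1 →
      Tendsto (freqLT (fun n => Int.fract (ω n)) r) atTop (𝓝 (r : ℝ)) := by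
    rw [ae_all_iff]
    intro r
    by_cases hr : 0 ≤ (r : ℝ) ∧ (r : ℝ) ≤ 1
    · filter_upwards [ae_tendsto_freqLT hr.1 hr.2] with ω hω _ _ using hω
    · exact ae_of_all _ fun ω h0 h1 => absurd ⟨h0, h1⟩ hr
  filter_upwards [h] with ω hω
  have hT : ∀ n, T q n (spreadSum q ω) ∈ Set.Ico (0 : ℝ) 1 := fun n =>
    ⟨Int.fract_nonneg _, Int.fract_lt_one _⟩
  exact uniformlyDistributedModOne_of_freqLT hT fun t h0 h1 =>
    tendsto_freqLT_of_tendsto_sub hT (tendsto_T_spreadSum_sub hq hlim ω) hω h0 h1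

end CantorSeries

/-! ### Hausdorff dimension -/

theorem mainTheorem6 (q : ℕ → ℕ) (hq : CantorSeries.IsBasicSequence q)
    (hlim : CantorSeries.InfiniteInLimit q) :
    dimH (CantorSeries.distributionNormal q \
      ⋃ j : ℕ, ⋃ _ : 1 ≤ j, CantorSeries.ratioNormalOfOrder q j) = 1 := by
  open CantorSeries MeasureTheory in
  refine le_antisymm ((dimH_mono (Set.subset_univ _)).trans Real.dimH_univ.le) ?_
  refine ENNReal.le_of_forall_nnreal_lt fun d hd => ?_
  have hd1 : (d : ℝ) < 1 := by exact_mod_cast hd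
  obtain ⟨K, hK, hle⟩ := exists_map_spreadSum_Icc_le hq hlim hd1
  refine le_dimH_of_measure_Icc_le hK hle fun h0 => ?_
  -- This inequality holds for arbitrary sets, so measurability of the exceptional set is not
  -- needed.
  have hpre := le_antisymm ((Measure.le_map_apply (measurable_spreadSum q).aemeasurable _).trans
    h0.le) bot_le
  have hae : ∀ᵐ ω ∂iidUnif, spreadSum q ω ∈ distributionNormal q \
      ⋃ j : ℕ, ⋃ _ : 1 ≤ j, ratioNormalOfOrder q j := by
    filter_upwards [ae_spreadSum_mem_distributionNormal hq hlim] with ω hω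
    refine ⟨hω, ?_⟩
    simp only [Set.mem_iUnion, not_exists]
    exact fun j hj => notMem_ratioNormalOfOrder
      (fun n => by rw [digit_spreadSum hq hlim, spreadDigit]; omega) hj
  have huniv : iidUnif Set.univ = 0 := by
    refine measure_mono_null (fun ω _ => ?_) (measure_union_null hpre (ae_iff.1 hae))
    by_cases h : spreadSum q ω ∈ distributionNormal q \
      ⋃ j : ℕ, ⋃ _ : 1 ≤ j, ratioNormalOfOrder q j
    · exact Or.inl h
    · exact Or.inr h
  simp at huniv
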